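/- All vector spaces are real and all operators are linear and bounded. Let $X, Y$ be Banach spaces and $E, F$ Banach lattices. Recall that $F$ is an AL-space if $\|x+y\|=\|x\|+\|y\|$ for all $x,y\ge 0$ in $F$, and $E$ is an AM-space if $\|x\vee y\|=\max\{\|x\|,\|y\|\}$ for all $x,y\ge 0$ in $E$. A sequence $(x_n)$ in a Banach lattice is disjoint if $|x_m|\wedge|x_n|=0$ for $m\ne n$. A norm bounded subset $A$ of $F$ is called an Lwc set if every disjoint sequence in its solid hull $\{y\in F: |y|\le|a| \text{ for some } a\in A\}$ converges to $0$ in norm. A bounded operator $T:X\to F$ is almost L-weakly compact, $T\in\mathrm{aLwc}(X,F)$, if it maps every relatively weakly compact subset of $X$ onto an Lwc subset of $F$. A bounded operator $T:E\to Y$ is almost M-weakly compact, $T\in\mathrm{aMwc}(E,Y)$, if $f_n(Tx_n)\to 0$ for every weakly convergent sequence $(f_n)$ in $Y^*$ (that is, convergent in $\sigma(Y^*,Y^{**})$ to some element of $Y^*$) and every norm bounded disjoint sequence $(x_n)$ in $E$. Let $\mathrm{L}(X,F)$ and $\mathrm{L}(E,Y)$ denote the spaces of all bounded linear operators. **Proposition.**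 (i) If $F$ is an AL-space, then $\mathrm{aLwc}(X,F)=\mathrm{L}(X,F)$, that is, every bounded operator $X\to F$ is almost L-weakly compact. (ii) If $E$ is an AM-space, then $\mathrm{aMwc}(E,Y)=\mathrm{L}(E,Y)$, that is, every bounded operator $E\to Y$ is almost M-weakly compact. -/

import Mathlib

open Filter Topology

/-- The norm of a Banach lattice is additive on the positive cone. -/
def IsALSpace (F : Type*) [NormedAddCommGroup F] [Lattice F] : Prop :=
  ∀ x y : F, 0 ≤ x → 0 ≤ y → ‖x + y‖ = ‖x‖ + ‖y‖

/-- The norm of a Banach lattice satisfies `‖x ⊔ y‖ = max ‖x‖ ‖y‖` on the positive cone. -/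
def IsAMSpace (E : Type*) [NormedAddCommGroup E] [Lattice E] : Prop :=
  ∀ x y : E, 0 ≤ x → 0 ≤ y → ‖x ⊔ y‖ = max ‖x‖ ‖y‖

/-- A sequence whose distinct terms are pairwise disjoint in the lattice sense. -/
def IsDisjointSeq {E : Type*} [AddCommGroup E] [Lattice E] (x : ℕ → E) : Prop :=
  ∀ m n : ℕ, m ≠ n → |x m| ⊓ |x n| = 0

/-- An Lwc set: a norm bounded set such that every disjoint sequence in its solid hull is norm
null. The solid hull of `A` is the set of all `y` with `|y| ≤ |a|` for some `a ∈ A`. -/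
def IsLwcSet {E : Type*} [NormedAddCommGroup E] [Lattice E] (A : Set E) : Prop :=
  Bornology.IsBounded A ∧
    ∀ x : ℕ → E, (∀ n, x n ∈ {y : E | ∃ a ∈ A, |y| ≤ |a|}) → IsDisjointSeq x →
      Tendsto (fun n => ‖x n‖) atTop (𝓝 0)

/-- The closure in the weak topology is weakly compact. -/
def IsRelativelyWeaklyCompact {X : Type*} [NormedAddCommGroup X] [NormedSpace ℝ X]
    (C : Set X) : Prop :=
  IsCompact (closure (toWeakSpace ℝ X '' C))

/-- Convergence of a sequence to a point in the weak topology. -/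
def WeaklyTendsto {X : Type*} [NormedAddCommGroup X] [NormedSpace ℝ X]
    (x : ℕ → X) (a : X) : Prop :=
  Tendsto (fun n => toWeakSpace ℝ X (x n)) atTop (𝓝 (toWeakSpace ℝ X a))

/-- An almost L-weakly compact operator. -/
def IsAlmostLWeaklyCompact {X F : Type*} [NormedAddCommGroup X] [NormedSpace ℝ X]
    [NormedAddCommGroup F] [NormedSpace ℝ F] [Lattice F] (T : X →L[ℝ] F) : Prop :=
  ∀ C : Set X, IsRelativelyWeaklyCompact C → IsLwcSet (T '' C)

/-- An almost M-weakly compact operator. Weak convergence of `f` is in the weak topology of the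
normed dual `Y*` (the one induced by `Y**`). -/
def IsAlmostMWeaklyCompact {E Y : Type*} [NormedAddCommGroup E] [NormedSpace ℝ E] [Lattice E]
    [NormedAddCommGroup Y] [NormedSpace ℝ Y] (T : E →L[ℝ] Y) : Prop :=
  ∀ f : ℕ → StrongDual ℝ Y, (∃ g : StrongDual ℝ Y, WeaklyTendsto f g) →
    ∀ x : ℕ → E, IsDisjointSeq x → Bornology.IsBounded (Set.range x) →
      Tendsto (fun n => f n (T (x n))) atTop (𝓝 0)

/-! Both halves reduce to the Schur property of `ℓ¹`: if `∑ |φ m v| ≤ C ‖v‖`, then `v ↦ (φ m v)` is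
a bounded operator into `ℓ¹`, so weakly convergent `v k` give `φ (n k) (v k) → 0` whenever `n k →
∞`.

AM case: take `φ m` to be evaluation at `T (x m)` on `Y*`. Sums of disjoint positive elements are
suprema, so signed partial sums of `x` stay bounded, which gives the `ℓ¹` bound.

AL case: let `|y m| ≤ |T (c m)|` with `y` disjoint. Hahn-Banach yields `ψ m`, dominated by the band
seminorm of `y m`, with `‖y m‖ ≤ ψ m (T (c m))`. Additivity of the norm gives the `ℓ¹` bound for `φ
m = ψ m ∘ T`. A subsequence of `c` that converges against functionals determined by the `φ m`
suffices, so Eberlein-Šmulian is avoided. -/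

set_option linter.unusedSectionVars false

/-! ### The Schur property, by Baire category on Cantor space. -/

section Schur

/-- **Schur property of `ℓ¹`**, diagonal form: if the rows of a matrix are summable and all their
subsums over a fixed set of columns tend to zero, then so do the entries along any choice of
columns that goes to infinity. -/
theorem tendsto_diagonal_of_tendsto_tsum_ite {t : ℕ → ℕ → ℝ}
    (hs : ∀ k, Summable fun m => |t k m|)
    (h : ∀ b : ℕ → Bool, Tendsto (fun k => ∑' m, if b m then t k m else 0) atTop (𝓝 0))
    {n : ℕ → ℕ} (hn : Tendsto n atTop atTop) :
    Tendsto (fun k => t k (n k)) atTop (𝓝 0) := by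
  have hle : ∀ (k m : ℕ) (b : ℕ → Bool), ‖(if b m then t k m else 0 : ℝ)‖ ≤ |t k m| := by
    intro k m b
    split_ifs <;> simp
  have hcont : ∀ k, Continuous fun b : ℕ → Bool => ∑' m, if b m then t k m else 0 := by
    intro k
    refine continuous_tsum (fun m => ?_) (hs k) (fun m b => hle k m b)
    exact (continuous_of_discreteTopology (f := fun c : Bool => if c then t k m else 0)).comp
      (continuous_apply m)
  rw [Metric.tendsto_atTop]
  intro ε hε
  -- By Baire, some `S N` contains a cylinder; changing a coordinate beyond its length `M` stays
  -- inside.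
  let S : ℕ → Set (ℕ → Bool) := fun N =>
    {b | ∀ k ≥ N, |∑' m, if b m then t k m else 0| ≤ ε / 3}
  have hclosed : ∀ N, IsClosed (S N) := by
    intro N
    simp only [S, Set.ofPred_forall]
    exact isClosed_iInter fun k => isClosed_iInter fun _ =>
      isClosed_le (hcont k).abs continuous_const
  have hcover : ⋃ N, S N = Set.univ := by
    refine Set.eq_univ_of_forall fun b => Set.mem_iUnion.2 ?_
    obtain ⟨N, hN⟩ := Metric.tendsto_atTop.1 (h b) (ε / 3) (by positivity)
    exact ⟨N, fun k hk => by simpa using (hN k hk).le⟩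
  obtain ⟨N, b, hb⟩ := nonempty_interior_of_iUnion_of_closed hclosed hcover
  obtain ⟨_, ⟨c, M, rfl⟩, hbc, hsub⟩ :=
    (PiNat.isTopologicalBasis_cylinders fun _ => Bool).exists_subset_of_mem_open hb
      isOpen_interior
  obtain ⟨K, hK⟩ := (hn.eventually_ge_atTop M).exists_forall_of_atTop
  refine ⟨max N K, fun k hk => ?_⟩
  have hkM : M ≤ n k := hK k ((le_max_right _ _).trans hk)
  have hmem : ∀ v : Bool, Function.update b (n k) v ∈ S N := by
    intro v
    refine interior_subset (hsub fun i hi => ?_)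
    rw [Function.update_of_ne (by omega)]
    exact hbc i hi
  have hsum : ∀ b : ℕ → Bool, Summable fun m => if b m then t k m else 0 :=
    fun b => (hs k).of_norm_bounded fun m => hle k m b
  -- The two selectors differ only in column `n k`; both subsums are at most `ε / 3` in modulus, so
  -- the entry is at most `2ε / 3 < ε`.
  have key : t k (n k) = (∑' m, if Function.update b (n k) true m then t k m else 0) -
      ∑' m, if Function.update b (n k) false m then t k m else 0 := by
    rw [← (hsum _).tsum_sub (hsum _), tsum_eq_single (n k)]
    · simp
    · intro m hm
      simp [Function.update_of_ne hm]
  have h₁ := abs_le.1 (hmem true k ((le_max_left _ _).trans hk))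
  have h₂ := abs_le.1 (hmem false k ((le_max_left _ _).trans hk))
  rw [Real.dist_eq, sub_zero, key, abs_lt]
  constructor <;> linarith [h₁.1, h₁.2, h₂.1, h₂.2]

variable {V : Type*} [NormedAddCommGroup V] [NormedSpace ℝ V]

theorem summable_abs_of_sum_le {φ : ℕ → StrongDual ℝ V} {C : ℝ}
    (hφ : ∀ v (N : ℕ), ∑ m ∈ Finset.range N, |φ m v| ≤ C * ‖v‖) (v : V) :
    Summable fun m => |φ m v| :=
  summable_of_sum_range_le (fun _ => abs_nonneg _) (hφ v)

/-- Subsums of an absolutely summable series of functionals are continuous functionals. -/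
theorem exists_strongDual_eq_tsum_ite {φ : ℕ → StrongDual ℝ V} {C : ℝ}
    (hφ : ∀ v (N : ℕ), ∑ m ∈ Finset.range N, |φ m v| ≤ C * ‖v‖) (b : ℕ → Bool) :
    ∃ Φ : StrongDual ℝ V, ∀ v, Φ v = ∑' m, if b m then φ m v else 0 := by
  have hle : ∀ v m, ‖(if b m then φ m v else 0 : ℝ)‖ ≤ |φ m v| := by
    intro v m
    split_ifs <;> simp
  have hs : ∀ v, Summable fun m => if b m then φ m v else 0 :=
    fun v => (summable_abs_of_sum_le hφ v).of_norm_bounded (hle v)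
  refine ⟨LinearMap.mkContinuous
    { toFun := fun v => ∑' m, if b m then φ m v else 0
      map_add' := fun v w => ?_
      map_smul' := fun c v => ?_ } C fun v => ?_, fun v => rfl⟩
  · rw [← (hs v).tsum_add (hs w)]
    exact tsum_congr fun m => by split_ifs <;> simp
  · rw [RingHom.id_apply, smul_eq_mul, ← tsum_mul_left]
    exact tsum_congr fun m => by split_ifs <;> simp
  · exact (tsum_of_norm_bounded (summable_abs_of_sum_le hφ v).hasSum (hle v)).trans
      (Real.tsum_le_of_sum_range_le (fun _ => abs_nonneg _) (hφ v))

/-- Absolutely summable functionals vanish along the diagonal of a sequence on which all their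
subsums converge. -/
theorem tendsto_diagonal_of_sum_le {φ : ℕ → StrongDual ℝ V} {C : ℝ}
    (hφ : ∀ v (N : ℕ), ∑ m ∈ Finset.range N, |φ m v| ≤ C * ‖v‖) {v : ℕ → V} {w : V}
    (hv : ∀ Φ : StrongDual ℝ V, (∀ x y, (∀ m, φ m x = φ m y) → Φ x = Φ y) →
      Tendsto (fun k => Φ (v k)) atTop (𝓝 (Φ w)))
    {n : ℕ → ℕ} (hn : Tendsto n atTop atTop) :
    Tendsto (fun k => φ (n k) (v k)) atTop (𝓝 0) := by
  have h₁ : Tendsto (fun k => φ (n k) (v k - w)) atTop (𝓝 0) := by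
    refine tendsto_diagonal_of_tendsto_tsum_ite (t := fun k m => φ m (v k - w))
      (fun k => summable_abs_of_sum_le hφ _) (fun b => ?_) hn
    obtain ⟨Φ, hΦ⟩ := exists_strongDual_eq_tsum_ite hφ b
    have hlim := (hv Φ fun x y hxy => by simp only [hΦ, hxy]).sub_const (Φ w)
    rw [sub_self] at hlim
    exact hlim.congr fun k => by rw [← map_sub, hΦ]
  have h₂ : Tendsto (fun k => φ (n k) w) atTop (𝓝 0) :=
    ((summable_abs_of_sum_le hφ w).of_abs.tendsto_atTop_zero).comp hn
  simpa using h₁.add h₂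

end Schur

/-! ### Relatively weakly compact sets. -/

section WeakTopology

variable {X : Type*} [NormedAddCommGroup X] [NormedSpace ℝ X]

theorem continuous_strongDual_weakSpace (f : StrongDual ℝ X) :
    Continuous fun x : WeakSpace ℝ X => f ((toWeakSpace ℝ X).symm x) :=
  WeakBilin.eval_continuous (topDualPairing ℝ X).flip f

/-- Uniform boundedness in the bidual: each functional is bounded on the compact weak closure. -/
theorem IsRelativelyWeaklyCompact.isBounded {C : Set X} (hC : IsRelativelyWeaklyCompact C) :
    Bornology.IsBounded C := by
  have hpt : ∀ f : StrongDual ℝ X, ∃ D, ∀ x : C,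
      ‖NormedSpace.inclusionInDoubleDual ℝ X x f‖ ≤ D := by
    intro f
    obtain ⟨D, hD⟩ := IsCompact.exists_bound_of_continuousOn hC
      (continuous_strongDual_weakSpace f).continuousOn
    exact ⟨D, fun x => hD _ (subset_closure ⟨x, x.2, rfl⟩)⟩
  obtain ⟨D, hD⟩ := banach_steinhaus hpt
  refine isBounded_iff_forall_norm_le.2 ⟨D, fun x hx => ?_⟩
  rw [← (NormedSpace.inclusionInDoubleDualLi ℝ (E := X)).norm_map x]
  exact hD ⟨x, hx⟩

/-- A sequence in a relatively weakly compact set has a subsequence that converges weakly as far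
as functionals determined by a given countable family can see. -/
theorem IsRelativelyWeaklyCompact.exists_subseq {C : Set X} (hC : IsRelativelyWeaklyCompact C)
    (φ : ℕ → StrongDual ℝ X) {x : ℕ → X} (hx : ∀ n, x n ∈ C) :
    ∃ (w : X) (s : ℕ → ℕ), StrictMono s ∧
      ∀ Φ : StrongDual ℝ X, (∀ x y, (∀ m, φ m x = φ m y) → Φ x = Φ y) →
        Tendsto (fun k => Φ (x (s k))) atTop (𝓝 (Φ w)) := by
  set K := closure (toWeakSpace ℝ X '' C)
  let P : WeakSpace ℝ X → ℕ → ℝ := fun z m => φ m ((toWeakSpace ℝ X).symm z)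
  have hP : Continuous P := continuous_pi fun m => continuous_strongDual_weakSpace (φ m)
  have hK : IsCompact K := hC
  have hxK : ∀ n, toWeakSpace ℝ X (x n) ∈ K := fun n => subset_closure ⟨_, hx n, rfl⟩
  -- The image of `K` under `P` is compact in the metrizable space `ℕ → ℝ`, hence sequentially
  -- compact.
  obtain ⟨_, ⟨z, hz, rfl⟩, s, hs, hlim⟩ :=
    (hK.image hP).tendsto_subseq (x := fun n => P (toWeakSpace ℝ X (x n)))
      fun n => ⟨_, hxK n, rfl⟩
  refine ⟨(toWeakSpace ℝ X).symm z, s, hs, fun Φ hΦ => ?_⟩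
  -- All cluster points in `K` lie in the fibre of `P` through `z`, so by compactness the
  -- subsequence converges to that fibre, on which `Φ` is constant.
  have hle : map (fun k => toWeakSpace ℝ X (x (s k))) atTop ≤ 𝓝ˢ {y | P y = P z} :=
    hK.le_nhdsSet_of_clusterPt (mem_map.2 (Eventually.of_forall fun k => hxK _))
      fun y _ hy => eq_of_nhds_neBot (hy.map hP.continuousAt (tendsto_map'_iff.2 hlim))
  have hΦz : Tendsto (fun y : WeakSpace ℝ X => Φ ((toWeakSpace ℝ X).symm y))
      (𝓝ˢ {y | P y = P z}) (𝓝 (Φ ((toWeakSpace ℝ X).symm z))) := by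
    intro U hU
    refine mem_nhdsSet_iff_forall.2 fun y hy => (continuous_strongDual_weakSpace Φ).tendsto y ?_
    rwa [hΦ _ _ fun m => congrFun hy m]
  exact hΦz.comp hle

end WeakTopology

/-! ### Disjoint sums in vector lattices. -/

section VectorLattice

variable {G : Type*} [AddCommGroup G] [Lattice G] [IsOrderedAddMonoid G]

theorem add_inf_le_inf_add_inf {a b c : G} (ha : 0 ≤ a) (hb : 0 ≤ b) (hc : 0 ≤ c) :
    (a + b) ⊓ c ≤ a ⊓ c + b ⊓ c := by
  rw [inf_add, add_inf, add_inf]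
  refine le_inf (le_inf inf_le_left ?_) (le_inf ?_ ?_)
  · exact inf_le_right.trans (le_add_of_nonneg_left ha)
  · exact inf_le_right.trans (le_add_of_nonneg_right hb)
  · exact inf_le_right.trans (le_add_of_nonneg_right hc)

theorem sum_range_inf_eq_zero {u : ℕ → G} (hu : ∀ m, 0 ≤ u m)
    (hd : ∀ m n, m ≠ n → u m ⊓ u n = 0) {N n : ℕ} (hn : N ≤ n) :
    (∑ m ∈ Finset.range N, u m) ⊓ u n = 0 := by
  induction N with
  | zero => simpa using hu n
  | succ N ih =>
    rw [Finset.sum_range_succ]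
    refine le_antisymm ?_ (le_inf (add_nonneg (Finset.sum_nonneg fun _ _ => hu _) (hu N)) (hu n))
    refine (add_inf_le_inf_add_inf (Finset.sum_nonneg fun _ _ => hu _) (hu N) (hu n)).trans ?_
    rw [ih (by omega), hd N n (by omega), add_zero]

/-- For disjoint positive elements, the sum is the supremum. -/
theorem sum_range_succ_eq_sup {u : ℕ → G} (hu : ∀ m, 0 ≤ u m)
    (hd : ∀ m n, m ≠ n → u m ⊓ u n = 0) (N : ℕ) :
    ∑ m ∈ Finset.range (N + 1), u m = (∑ m ∈ Finset.range N, u m) ⊔ u N := by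
  rw [Finset.sum_range_succ, ← inf_add_sup, sum_range_inf_eq_zero hu hd le_rfl, zero_add]

theorem sum_range_le_of_disjoint {u : ℕ → G} (hu : ∀ m, 0 ≤ u m)
    (hd : ∀ m n, m ≠ n → u m ⊓ u n = 0) {a : G} (ha : 0 ≤ a) (hua : ∀ m, u m ≤ a) (N : ℕ) :
    ∑ m ∈ Finset.range N, u m ≤ a := by
  induction N with
  | zero => simpa using ha
  | succ N ih =>
    rw [sum_range_succ_eq_sup hu hd]
    exact sup_le ih (hua N)

theorem abs_sum_range_le (x : ℕ → G) (N : ℕ) :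
    |∑ m ∈ Finset.range N, x m| ≤ ∑ m ∈ Finset.range N, |x m| :=
  Finset.le_sum_of_subadditive _ abs_zero.le abs_add_le _ _

variable [Module ℝ G] [IsOrderedModule ℝ G]

theorem smul_inf_of_pos {c : ℝ} (hc : 0 < c) (a b : G) : c • (a ⊓ b) = c • a ⊓ c • b :=
  (OrderIso.smulRight hc).map_inf a b

theorem abs_smul_of_pos {c : ℝ} (hc : 0 < c) (a : G) : |c • a| = c • |a| := by
  have h := (OrderIso.smulRight (β := G) hc).map_sup a (-a)
  simp only [OrderIso.smulRight_apply, smul_neg] at h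
  exact h.symm

end VectorLattice

/-! ### Band seminorms and the two `ℓ¹` bounds. -/

section BanachLattice

variable {F : Type*} [NormedAddCommGroup F] [NormedSpace ℝ F] [Lattice F]
  [IsOrderedAddMonoid F] [IsOrderedModule ℝ F] [HasSolidNorm F]

theorem norm_le_norm_of_nonneg_of_le {a b : F} (ha : 0 ≤ a) (hab : a ≤ b) : ‖a‖ ≤ ‖b‖ :=
  norm_le_norm_of_abs_le_abs (by rwa [abs_of_nonneg ha, abs_of_nonneg (ha.trans hab)])

/-- The seminorm `a ↦ sup_k ‖|a| ⊓ k|y|‖`. When the norm is order continuous it is the norm of the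
component of `a` in the band generated by `y`. -/
noncomputable def bandSeminorm (y a : F) : ℝ :=
  ⨆ k : Set.Ioi (0 : ℝ), ‖|a| ⊓ (k : ℝ) • |y|‖

theorem inf_smul_abs_nonneg (y a : F) (k : Set.Ioi (0 : ℝ)) : 0 ≤ |a| ⊓ (k : ℝ) • |y| :=
  le_inf (abs_nonneg a) (smul_nonneg (le_of_lt k.2) (abs_nonneg y))

theorem norm_inf_smul_abs_le (y a : F) (k : Set.Ioi (0 : ℝ)) : ‖|a| ⊓ (k : ℝ) • |y|‖ ≤ ‖a‖ :=
  (norm_le_norm_of_nonneg_of_le (inf_smul_abs_nonneg y a k) inf_le_left).trans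
    (norm_abs_eq_norm a).le

theorem bddAbove_bandSeminorm (y a : F) :
    BddAbove (Set.range fun k : Set.Ioi (0 : ℝ) => ‖|a| ⊓ (k : ℝ) • |y|‖) :=
  ⟨‖a‖, Set.forall_mem_range.2 (norm_inf_smul_abs_le y a)⟩

theorem le_bandSeminorm (y a : F) (k : Set.Ioi (0 : ℝ)) :
    ‖|a| ⊓ (k : ℝ) • |y|‖ ≤ bandSeminorm y a :=
  le_ciSup (bddAbove_bandSeminorm y a) k

theorem bandSeminorm_nonneg (y a : F) : 0 ≤ bandSeminorm y a :=
  Real.iSup_nonneg fun _ => norm_nonneg _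

theorem bandSeminorm_neg (y a : F) : bandSeminorm y (-a) = bandSeminorm y a := by
  simp only [bandSeminorm, abs_neg]

theorem bandSeminorm_add_le (y a b : F) :
    bandSeminorm y (a + b) ≤ bandSeminorm y a + bandSeminorm y b := by
  refine ciSup_le fun k => ?_
  have h : |a + b| ⊓ (k : ℝ) • |y| ≤ |a| ⊓ (k : ℝ) • |y| + |b| ⊓ (k : ℝ) • |y| :=
    (inf_le_inf_right _ (abs_add_le a b)).trans (add_inf_le_inf_add_inf (abs_nonneg a)
      (abs_nonneg b) (smul_nonneg (le_of_lt k.2) (abs_nonneg y)))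
  exact ((norm_le_norm_of_nonneg_of_le (inf_smul_abs_nonneg y _ k) h).trans
    (norm_add_le _ _)).trans (add_le_add (le_bandSeminorm y a k) (le_bandSeminorm y b k))

theorem bandSeminorm_smul_le (y a : F) {c : ℝ} (hc : 0 < c) :
    bandSeminorm y (c • a) ≤ c * bandSeminorm y a := by
  refine ciSup_le fun k => ?_
  have hk : 0 < c⁻¹ * (k : ℝ) := mul_pos (inv_pos.2 hc) k.2
  have h : |c • a| ⊓ (k : ℝ) • |y| = c • (|a| ⊓ (c⁻¹ * (k : ℝ)) • |y|) := by
    rw [abs_smul_of_pos hc, smul_inf_of_pos hc, smul_smul, mul_inv_cancel_left₀ hc.ne']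
  rw [h, norm_smul, Real.norm_of_nonneg hc.le]
  exact mul_le_mul_of_nonneg_left (le_bandSeminorm y a ⟨_, hk⟩) hc.le

theorem bandSeminorm_smul (y a : F) {c : ℝ} (hc : 0 < c) :
    bandSeminorm y (c • a) = c * bandSeminorm y a := by
  refine le_antisymm (bandSeminorm_smul_le y a hc) ?_
  have h := bandSeminorm_smul_le y (c • a) (inv_pos.2 hc)
  rwa [inv_smul_smul₀ hc.ne', inv_mul_eq_div, le_div_iff₀' hc] at h

theorem bandSeminorm_le_norm (y a : F) : bandSeminorm y a ≤ ‖a‖ :=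
  ciSup_le (norm_inf_smul_abs_le y a)

theorem norm_le_bandSeminorm {y a : F} (h : |y| ≤ |a|) : ‖y‖ ≤ bandSeminorm y a := by
  have h₁ := le_bandSeminorm y a ⟨1, Set.mem_Ioi.2 one_pos⟩
  rwa [one_smul, inf_eq_right.2 h, norm_abs_eq_norm] at h₁

/-- Hahn-Banach for the sublinear `bandSeminorm y`, extending from the line through `a`; continuity
follows from `bandSeminorm_le_norm`. -/
theorem exists_strongDual_eq_bandSeminorm (y a : F) :
    ∃ ψ : StrongDual ℝ F, ψ a = bandSeminorm y a ∧ ∀ v, |ψ v| ≤ bandSeminorm y v := by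
  have hext : ∃ g : F →ₗ[ℝ] ℝ, g a = bandSeminorm y a ∧ ∀ v, g v ≤ bandSeminorm y v := by
    rcases eq_or_ne a 0 with rfl | ha
    · refine ⟨0, ?_, fun v => bandSeminorm_nonneg y v⟩
      exact le_antisymm (bandSeminorm_nonneg y 0) (by simpa using bandSeminorm_le_norm y 0)
    · obtain ⟨g, hg, hle⟩ := exists_extension_of_le_sublinear
        (LinearPMap.mkSpanSingleton a (bandSeminorm y a) ha) (bandSeminorm y)
        (fun c hc v => bandSeminorm_smul y v hc) (bandSeminorm_add_le y) (by
          rintro ⟨v, hv⟩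
          obtain ⟨c, rfl⟩ := Submodule.mem_span_singleton.1 hv
          rw [LinearPMap.mkSpanSingleton'_apply, RingHom.id_apply, smul_eq_mul]
          rcases lt_or_ge 0 c with hc | hc
          · exact (bandSeminorm_smul y a hc).ge
          · exact (mul_nonpos_of_nonpos_of_nonneg hc (bandSeminorm_nonneg y a)).trans
              (bandSeminorm_nonneg y _))
      refine ⟨g, ?_, hle⟩
      rw [hg ⟨a, Submodule.mem_span_singleton_self a⟩]
      exact LinearPMap.mkSpanSingleton_apply ℝ ℝ ha _
  obtain ⟨g, hga, hle⟩ := hext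
  have habs : ∀ v, |g v| ≤ bandSeminorm y v := fun v =>
    abs_le'.2 ⟨hle v, by simpa [bandSeminorm_neg] using hle (-v)⟩
  exact ⟨g.mkContinuous 1 fun v => by simpa using (habs v).trans (bandSeminorm_le_norm y v),
    hga, habs⟩

theorem IsALSpace.norm_sum_range (hF : IsALSpace F) {u : ℕ → F} (hu : ∀ m, 0 ≤ u m) (N : ℕ) :
    ‖∑ m ∈ Finset.range N, u m‖ = ∑ m ∈ Finset.range N, ‖u m‖ := by
  induction N with
  | zero => simp
  | succ N ih =>
    rw [Finset.sum_range_succ, Finset.sum_range_succ,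
      hF _ _ (Finset.sum_nonneg fun _ _ => hu _) (hu N), ih]

/-- For fixed `k` the elements `|a| ⊓ k • |y m|` are disjoint and below `|a|`, hence so is their
sum, whose norm is the sum of norms. The truncations increase with `k`, so one limit serves all `m`.
-/
theorem IsALSpace.sum_bandSeminorm_le (hF : IsALSpace F) {y : ℕ → F} (hy : IsDisjointSeq y)
    (a : F) (N : ℕ) : ∑ m ∈ Finset.range N, bandSeminorm (y m) a ≤ ‖a‖ := by
  have hlim : ∀ m, Tendsto (fun k : Set.Ioi (0 : ℝ) => ‖|a| ⊓ (k : ℝ) • |y m|‖) atTop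
      (𝓝 (bandSeminorm (y m) a)) := fun m =>
    tendsto_atTop_ciSup (fun k l hkl => norm_le_norm_of_nonneg_of_le (inf_smul_abs_nonneg _ _ k)
      (inf_le_inf_left _ (smul_le_smul_of_nonneg_right hkl (abs_nonneg _))))
      (bddAbove_bandSeminorm _ _)
  refine le_of_tendsto' (tendsto_finsetSum _ fun m _ => hlim m) fun k => ?_
  have hu := fun m => inf_smul_abs_nonneg (y m) a k
  rw [← hF.norm_sum_range hu, ← norm_abs_eq_norm a]
  refine norm_le_norm_of_nonneg_of_le (Finset.sum_nonneg fun m _ => hu m)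
    (sum_range_le_of_disjoint hu (fun m n hmn => ?_) (abs_nonneg a) (fun m => inf_le_left) N)
  refine le_antisymm ((inf_le_inf inf_le_right inf_le_right).trans ?_) (le_inf (hu m) (hu n))
  rw [← smul_inf_of_pos k.2, hy m n hmn, smul_zero]

theorem IsAMSpace.norm_sum_range_le (hF : IsAMSpace F) {x : ℕ → F} (hx : IsDisjointSeq x) {D : ℝ}
    (hD : ∀ n, ‖x n‖ ≤ D) (N : ℕ) : ‖∑ m ∈ Finset.range N, |x m|‖ ≤ D := by
  induction N with
  | zero => simpa using (norm_nonneg _).trans (hD 0)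
  | succ N ih =>
    rw [sum_range_succ_eq_sup (fun m => abs_nonneg (x m)) hx,
      hF _ _ (Finset.sum_nonneg fun _ _ => abs_nonneg _) (abs_nonneg _), norm_abs_eq_norm]
    exact max_le ih (hD N)

theorem IsAMSpace.sum_abs_apply_le (hF : IsAMSpace F) {x : ℕ → F} (hx : IsDisjointSeq x) {D : ℝ}
    (hD : ∀ n, ‖x n‖ ≤ D) (f : StrongDual ℝ F) (N : ℕ) :
    ∑ m ∈ Finset.range N, |f (x m)| ≤ ‖f‖ * D := by
  -- Signs are chosen so that `f (z m) = |f (x m)|`, without changing `|x m|`.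
  let z : ℕ → F := fun m => if 0 ≤ f (x m) then x m else -x m
  have hz : ∀ m, |z m| = |x m| := fun m => by
    simp only [z]
    split_ifs <;> simp
  have hfz : ∑ m ∈ Finset.range N, |f (x m)| = f (∑ m ∈ Finset.range N, z m) := by
    rw [map_sum]
    refine Finset.sum_congr rfl fun m _ => ?_
    simp only [z]
    split_ifs with h
    · exact abs_of_nonneg h
    · rw [map_neg, abs_of_neg (not_le.1 h)]
  rw [hfz]
  refine (le_abs_self _).trans ((f.le_opNorm _).trans
    (mul_le_mul_of_nonneg_left ?_ (norm_nonneg f)))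
  refine le_trans (norm_le_norm_of_abs_le_abs ?_) (hF.norm_sum_range_le hx hD N)
  exact (abs_sum_range_le z N).trans ((Finset.sum_congr rfl fun m _ => hz m).le.trans
    (le_abs_self _))

theorem IsALSpace.isAlmostLWeaklyCompact (hF : IsALSpace F) {X : Type*} [NormedAddCommGroup X]
    [NormedSpace ℝ X] (T : X →L[ℝ] F) : IsAlmostLWeaklyCompact T := by
  intro C hC
  refine ⟨T.lipschitz.isBounded_image hC.isBounded, fun y hy hdisj => ?_⟩
  have hy' : ∀ n, ∃ c ∈ C, |y n| ≤ |T c| := fun n => by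
    obtain ⟨_, ⟨c, hc, rfl⟩, h⟩ := hy n
    exact ⟨c, hc, h⟩
  choose c hc hyc using hy'
  choose ψ hψ hψle using fun n => exists_strongDual_eq_bandSeminorm (y n) (T (c n))
  let φ : ℕ → StrongDual ℝ X := fun m => (ψ m).comp T
  have hφ : ∀ v (N : ℕ), ∑ m ∈ Finset.range N, |φ m v| ≤ ‖T‖ * ‖v‖ := fun v N =>
    (Finset.sum_le_sum fun m _ => hψle m (T v)).trans
      ((hF.sum_bandSeminorm_le hdisj (T v) N).trans (T.le_opNorm v))
  refine tendsto_of_subseq_tendsto fun ns hns => ?_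
  obtain ⟨w, s, hs, hw⟩ := hC.exists_subseq φ fun n => hc (ns n)
  refine ⟨s, squeeze_zero (fun k => norm_nonneg _) (fun k => ?_)
    (tendsto_diagonal_of_sum_le hφ hw (hns.comp hs.tendsto_atTop))⟩
  exact (norm_le_bandSeminorm (hyc _)).trans (hψ _).ge

theorem IsAMSpace.isAlmostMWeaklyCompact (hF : IsAMSpace F) {Y : Type*} [NormedAddCommGroup Y]
    [NormedSpace ℝ Y] (T : F →L[ℝ] Y) : IsAlmostMWeaklyCompact T := by
  rintro f ⟨g, hfg⟩ x hx hbdd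
  obtain ⟨D, hD⟩ := isBounded_iff_forall_norm_le.1 hbdd
  have hxD : ∀ n, ‖x n‖ ≤ D := fun n => hD _ (Set.mem_range_self n)
  let φ : ℕ → StrongDual ℝ (StrongDual ℝ Y) := fun m =>
    NormedSpace.inclusionInDoubleDual ℝ Y (T (x m))
  have hφ : ∀ v (N : ℕ), ∑ m ∈ Finset.range N, |φ m v| ≤ (‖T‖ * D) * ‖v‖ := fun v N => by
    refine (hF.sum_abs_apply_le hx hxD (v.comp T) N).trans ?_
    rw [mul_comm, mul_comm ‖T‖, mul_assoc, mul_comm ‖T‖]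
    exact mul_le_mul_of_nonneg_left (v.opNorm_comp_le T) ((norm_nonneg _).trans (hxD 0))
  -- Here the `f k` are the vectors, and weak convergence in `Y*` covers every `Φ` in `Y**`.
  exact tendsto_diagonal_of_sum_le hφ
    (fun Φ _ => ((continuous_strongDual_weakSpace Φ).tendsto _).comp hfg) tendsto_id

end BanachLattice

theorem mainTheorem11
    {X Y E F : Type*}
    [NormedAddCommGroup X] [NormedSpace ℝ X] [CompleteSpace X]
    [NormedAddCommGroup Y] [NormedSpace ℝ Y] [CompleteSpace Y]
    [NormedAddCommGroup E] [NormedSpace ℝ E] [CompleteSpace E]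
    [Lattice E] [IsOrderedAddMonoid E] [IsOrderedModule ℝ E] [HasSolidNorm E]
    [NormedAddCommGroup F] [NormedSpace ℝ F] [CompleteSpace F]
    [Lattice F] [IsOrderedAddMonoid F] [IsOrderedModule ℝ F] [HasSolidNorm F] :
    (IsALSpace F → ∀ T : X →L[ℝ] F, IsAlmostLWeaklyCompact T) ∧
      (IsAMSpace E → ∀ T : E →L[ℝ] Y, IsAlmostMWeaklyCompact T) := by
  exact ⟨fun hF T => hF.isAlmostLWeaklyCompact T, fun hE T => hE.isAlmostMWeaklyCompact T⟩
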